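/- A closed convex cone $\mathcal K\subseteq\mathbb R^n$ is called projectionally exposed if for every (nonempty) face $F$ of $\mathcal K$ there is an idempotent linear map $P:\mathbb R^n\to\mathbb R^n$ (a linear projection, not necessarily orthogonal) with $P(\mathcal K)=F$. It is called amenable if for every (nonempty) face $F$ of $\mathcal K$ there is a constant $\kappa>0$ (possibly depending on $F$) such that $\operatorname{dist}(x,F)\le\kappa\,\operatorname{dist}(x,\mathcal K)$ for all $x$ in the linear span of $F$. Theorem. There exist two closed convex cones $\tilde{\mathcal K}_1,\tilde{\mathcal K}_2\subset\mathbb R^5$ such that both $\tilde{\mathcal K}_1$ and $\tilde{\mathcal K}_2$ are projectionally exposed, but their intersection $\tilde{\mathcal K}_1\cap\tilde{\mathcal K}_2$ is not projectionally exposed. Moreover, $\tilde{\mathcal K}_1\cap\tilde{\mathcal K}_2$ is an amenable cone; thus it is a closed convex cone that is amenable but not projectionally exposed. -/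

import Mathlib

/-!
Closed convex cones in a finite-dimensional Euclidean space, their faces, and two notions of
exposedness of faces.

A (nonempty) closed convex cone contains the origin, so it is a `PointedCone` (a convex cone
containing `0`; lines in the cone are allowed) whose underlying set is closed.  A nonempty face
(convex extreme subset) of such a cone is again a convex cone containing `0`, and these are
exactly the cones `F` with `PointedCone.IsFaceOf F K`.
-/

namespace ConvexCones

/-- `F` is a projectionally exposed face of `K`: it is a face, and there is an idempotent linear
map `P` (not necessarily an orthogonal projection) with `P(K) = F`. -/
def IsProjectionallyExposedFace {E : Type*} [AddCommGroup E] [Module ℝ E]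
    (F K : PointedCone ℝ E) : Prop :=
  F.IsFaceOf K ∧ ∃ P : E →ₗ[ℝ] E, IsIdempotentElem P ∧ P '' (K : Set E) = (F : Set E)

/-- `K` is projectionally exposed: every face of `K` is projectionally exposed. -/
def IsProjectionallyExposed {E : Type*} [AddCommGroup E] [Module ℝ E]
    (K : PointedCone ℝ E) : Prop :=
  ∀ F : PointedCone ℝ E, F.IsFaceOf K → IsProjectionallyExposedFace F K

/-- `F` is an amenable face of `K`: it is a face, and there is a constant `κ > 0` with
`dist (x, F) ≤ κ * dist (x, K)` for all `x` in the linear span of `F`. -/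
def IsAmenableFace {E : Type*} [NormedAddCommGroup E] [NormedSpace ℝ E]
    (F K : PointedCone ℝ E) : Prop :=
  F.IsFaceOf K ∧ ∃ κ : ℝ, 0 < κ ∧ ∀ x ∈ Submodule.span ℝ (F : Set E),
    Metric.infDist x (F : Set E) ≤ κ * Metric.infDist x (K : Set E)

/-- `K` is amenable: every face of `K` is amenable (the constant may depend on the face). -/
def IsAmenable {E : Type*} [NormedAddCommGroup E] [NormedSpace ℝ E]
    (K : PointedCone ℝ E) : Prop :=
  ∀ F : PointedCone ℝ E, F.IsFaceOf K → IsAmenableFace F K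

end ConvexCones

namespace ConvexCones

/-! ### Faces and a criterion for amenability -/

section General

variable {E : Type*}

/-! Put p = x₀ + x₁, s = x₀ + x₁ - x₂ - x₃, t = x₄. Intersect the curved cylinder s² ≤ pt with the
orthant.

The face t = 0 of the intersection is a cone over a square (`squareFace`). The intersection is
tangent to it: leaving the hyperplane s = 0 by ε costs only O(ε²) in t. Hence a linear projection
onto the face cannot give a zero coordinate a nonzero first-order change. These constraints
determine P too rigidly for its image to satisfy s = 0 (`not_isProjectionallyExposed_inf`).

Amenability tolerates the curvature: a face either contains an interior point of the cylinder, which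
absorbs errors, or spans a subspace on which s² = pt identically, where only the linear inequalities
of the orthant remain (`isAmenable_inf`). -/

/-- A face of a convex cone contains every point of the cone that lies in its linear span. -/
theorem mem_face_of_mem_span [AddCommGroup E] [Module ℝ E] {F K : PointedCone ℝ E}
    (hF : F.IsFaceOf K) {x : E} (hx : x ∈ K) (hs : x ∈ Submodule.span ℝ (F : Set E)) : x ∈ F := by
  -- The span of a cone is F - F. If x = a - b, then x + b = a lies in the face, hence so does x.
  have key : ∃ a ∈ F, ∃ b ∈ F, x = a - b := by
    clear hx
    induction hs using Submodule.span_induction with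
    | mem x h => exact ⟨x, h, 0, F.zero_mem, by simp⟩
    | zero => exact ⟨0, F.zero_mem, 0, F.zero_mem, by simp⟩
    | add x y _ _ hx hy =>
      obtain ⟨a, ha, b, hb, rfl⟩ := hx
      obtain ⟨c, hc, d, hd, rfl⟩ := hy
      exact ⟨a + c, F.add_mem ha hc, b + d, F.add_mem hb hd, by abel⟩
    | smul r x _ hx =>
      obtain ⟨a, ha, b, hb, rfl⟩ := hx
      rcases le_total 0 r with h | h
      · exact ⟨r • a, PointedCone.smul_mem _ h ha, r • b, PointedCone.smul_mem _ h hb,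
          smul_sub _ _ _⟩
      · refine ⟨(-r) • b, PointedCone.smul_mem _ (neg_nonneg.2 h) hb,
          (-r) • a, PointedCone.smul_mem _ (neg_nonneg.2 h) ha, ?_⟩
        module
  obtain ⟨a, ha, b, hb, rfl⟩ := key
  exact hF.mem_of_add_mem_left hx (hF.le hb) (by simpa using ha)

/-- A face `F` of `K` is amenable if some `e ∈ F` and `c` satisfy `x + c * ‖x - y‖ • e ∈ K` for all
`x` in the span of `F` and all `y ∈ K`. -/
theorem isAmenableFace_of_forall_add_smul_mem [NormedAddCommGroup E] [NormedSpace ℝ E]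
    {F K : PointedCone ℝ E} (hF : F.IsFaceOf K) {e : E} (he : e ∈ F) {c : ℝ} (hc : 0 ≤ c)
    (h : ∀ x ∈ Submodule.span ℝ (F : Set E), ∀ y ∈ K, x + (c * ‖x - y‖) • e ∈ K) :
    IsAmenableFace F K := by
  have hpos : 0 < c * ‖e‖ + 1 := by positivity
  refine ⟨hF, c * ‖e‖ + 1, hpos, fun x hx => ?_⟩
  rw [← div_le_iff₀' hpos, Metric.le_infDist ⟨0, K.zero_mem⟩]
  intro y hy
  rw [div_le_iff₀' hpos]
  have hz : x + (c * ‖x - y‖) • e ∈ F :=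
    mem_face_of_mem_span hF (h x hx y hy)
      (Submodule.add_mem _ hx (Submodule.smul_mem _ _ (Submodule.subset_span he)))
  refine (Metric.infDist_le_dist_of_mem hz).trans ?_
  rw [dist_self_add_right, norm_smul, Real.norm_of_nonneg (by positivity), dist_eq_norm]
  nlinarith [norm_nonneg (x - y)]

end General

/-! ### The two cones -/

/-- Reverse Cauchy–Schwarz inequality on the cone `s ^ 2 ≤ p * t`. -/
theorem two_mul_mul_le_of_sq_le {p s t p' s' t' : ℝ} (hp : 0 ≤ p) (ht : 0 ≤ t) (hs : s ^ 2 ≤ p * t)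
    (hp' : 0 ≤ p') (ht' : 0 ≤ t') (hs' : s' ^ 2 ≤ p' * t') : 2 * (s * s') ≤ p * t' + p' * t := by
  refine le_of_sq_le_sq ?_ (by positivity)
  nlinarith [sq_nonneg (p * t' - p' * t), mul_le_mul hs hs' (sq_nonneg _) (by positivity)]

local notation "V" => EuclideanSpace ℝ (Fin 5)

/-- The product of a three-dimensional Lorentz cone with a plane, in coordinates adapted to the
nonnegative orthant. -/
def lorentzCylinder : PointedCone ℝ V where
  carrier := {x | 0 ≤ x 0 + x 1 ∧ 0 ≤ x 4 ∧ (x 0 + x 1 - x 2 - x 3) ^ 2 ≤ (x 0 + x 1) * x 4}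
  zero_mem' := by simp
  add_mem' := by
    rintro x y ⟨h1, h2, h3⟩ ⟨h4, h5, h6⟩
    have := two_mul_mul_le_of_sq_le h1 h2 h3 h4 h5 h6
    simp only [Set.mem_ofPred_eq, PiLp.add_apply]
    exact ⟨by linarith, by linarith, by nlinarith⟩
  smul_mem' := by
    rintro ⟨c, hc⟩ x ⟨h1, h2, h3⟩
    simp only [Set.mem_ofPred_eq, Nonneg.mk_smul, PiLp.smul_apply, smul_eq_mul]
    refine ⟨?_, by positivity, ?_⟩
    · rw [← mul_add]; positivity
    · nlinarith [mul_le_mul_of_nonneg_left h3 (sq_nonneg c)]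

/-- The nonnegative orthant. -/
def orthant : PointedCone ℝ V where
  carrier := {x | ∀ i, 0 ≤ x i}
  zero_mem' := by simp
  add_mem' := fun hx hy i => add_nonneg (hx i) (hy i)
  smul_mem' := fun c _ hx i => mul_nonneg c.2 (hx i)

theorem mem_lorentzCylinder {x : V} : x ∈ lorentzCylinder ↔
    0 ≤ x 0 + x 1 ∧ 0 ≤ x 4 ∧ (x 0 + x 1 - x 2 - x 3) ^ 2 ≤ (x 0 + x 1) * x 4 := Iff.rfl

theorem mem_orthant {x : V} : x ∈ orthant ↔ ∀ i, 0 ≤ x i := Iff.rfl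

theorem isClosed_lorentzCylinder : IsClosed (lorentzCylinder : Set V) := by
  have : (lorentzCylinder : Set V) = {x : V | 0 ≤ x 0 + x 1} ∩ ({x : V | 0 ≤ x 4} ∩
      {x : V | (x 0 + x 1 - x 2 - x 3) ^ 2 ≤ (x 0 + x 1) * x 4}) := rfl
  rw [this]
  refine .inter ?_ (.inter ?_ ?_) <;> exact isClosed_le (by fun_prop) (by fun_prop)

theorem isClosed_orthant : IsClosed (orthant : Set V) := by
  have : (orthant : Set V) = ⋂ i, {x : V | 0 ≤ x i} := by ext; simp [mem_orthant]
  rw [this]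
  exact isClosed_iInter fun i => isClosed_le (by fun_prop) (by fun_prop)

/-- An interior point of the Lorentz cylinder is an order unit for it. -/
theorem exists_smul_add_mem_lorentzCylinder {w : V} (hw : w ∈ lorentzCylinder)
    (hQ : (w 0 + w 1 - w 2 - w 3) ^ 2 < (w 0 + w 1) * w 4) :
    ∃ c : ℝ, 0 < c ∧ ∀ v : V, (c * ‖v‖) • w + v ∈ lorentzCylinder := by
  have hpos : 0 < (w 0 + w 1) * w 4 := (sq_nonneg _).trans_lt hQ
  have hU : IsOpen {x : V | 0 < x 0 + x 1 ∧ 0 < x 4 ∧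
      (x 0 + x 1 - x 2 - x 3) ^ 2 < (x 0 + x 1) * x 4} := by
    refine .and ?_ (.and ?_ ?_) <;> exact isOpen_lt (by fun_prop) (by fun_prop)
  obtain ⟨r, hr, hball⟩ := Metric.isOpen_iff.1 hU w
    ⟨pos_of_mul_pos_left hpos hw.2.1, pos_of_mul_pos_right hpos hw.1, hQ⟩
  refine ⟨2 / r, by positivity, fun v => ?_⟩
  rcases eq_or_ne v 0 with rfl | hv
  · simp
  have hv' : 0 < ‖v‖ := norm_pos_iff.2 hv
  have hmem : w + (r / (2 * ‖v‖)) • v ∈ Metric.ball w r := by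
    rw [mem_ball_iff_norm, add_sub_cancel_left, norm_smul, Real.norm_of_nonneg (by positivity)]
    field_simp
    linarith
  obtain ⟨h1, h2, h3⟩ := hball hmem
  have := PointedCone.smul_mem lorentzCylinder (x := w + (r / (2 * ‖v‖)) • v)
    (show (0 : ℝ) ≤ 2 / r * ‖v‖ by positivity) ⟨h1.le, h2.le, h3.le⟩
  rw [smul_add, smul_smul] at this
  convert this using 2
  have : 2 / r * ‖v‖ * (r / (2 * ‖v‖)) = 1 := by field_simp
  rw [this, one_smul]

/-! ### Projectional exposedness of the two cones -/

/-- Two points of a cone inside the boundary of the Lorentz cylinder have proportional Lorentz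
components. -/
theorem polar_eq_of_boundary {F : PointedCone ℝ V}
    (hQ : ∀ w ∈ F, (w 0 + w 1 - w 2 - w 3) ^ 2 = (w 0 + w 1) * w 4) {x y : V} (hx : x ∈ F)
    (hy : y ∈ F) : 2 * ((x 0 + x 1 - x 2 - x 3) * (y 0 + y 1 - y 2 - y 3)) =
      (x 0 + x 1) * y 4 + (y 0 + y 1) * x 4 := by
  have h := hQ _ (F.add_mem hx hy)
  simp only [PiLp.add_apply] at h
  linarith [hQ x hx, hQ y hy, h]

/-- The projection onto the lineality space of the Lorentz cylinder. -/
noncomputable def linealityProj : V →ₗ[ℝ] V where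
  toFun x := !₂[(x 0 - x 1) / 2, (x 1 - x 0) / 2, (x 2 - x 3) / 2, (x 3 - x 2) / 2, 0]
  map_add' x y := by
    ext i; fin_cases i <;> simp <;> ring
  map_smul' c x := by
    ext i; fin_cases i <;> simp <;> ring

theorem linealityProj_apply (x : V) : linealityProj x =
    !₂[(x 0 - x 1) / 2, (x 1 - x 0) / 2, (x 2 - x 3) / 2, (x 3 - x 2) / 2, 0] := rfl

/-- The height functional of the Lorentz cylinder. -/
def height : V →ₗ[ℝ] ℝ where
  toFun x := x 0 + x 1 + x 4
  map_add' x y := by simp; ring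
  map_smul' c x := by simp; ring

theorem height_apply (x : V) : height x = x 0 + x 1 + x 4 := rfl

theorem linealityProj_mem_face {F : PointedCone ℝ V} (hF : F.IsFaceOf lorentzCylinder) (x : V) :
    linealityProj x ∈ F := by
  have h (y : V) : linealityProj y ∈ lorentzCylinder := by
    rw [mem_lorentzCylinder]
    refine ⟨le_of_eq ?_, le_of_eq ?_, le_of_eq ?_⟩ <;> simp [linealityProj_apply] <;> ring
  refine hF.mem_of_add_mem_left (h x) (h (-x)) ?_
  rw [map_neg, add_neg_cancel]
  exact F.zero_mem

/-- A face with an interior point is the whole cylinder. Any other face is the lineality space,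
alone or plus a single ray. -/
theorem isProjectionallyExposed_lorentzCylinder : IsProjectionallyExposed lorentzCylinder := by
  intro F hF
  refine ⟨hF, ?_⟩
  by_cases hint : ∃ w ∈ F, (w 0 + w 1 - w 2 - w 3) ^ 2 < (w 0 + w 1) * w 4
  · obtain ⟨w, hw, hQ⟩ := hint
    obtain ⟨c, hc, h⟩ := exists_smul_add_mem_lorentzCylinder (hF.le hw) hQ
    have hle : lorentzCylinder ≤ F := fun y hy =>
      hF.mem_of_add_mem_left hy (h (-y)) (by
        rw [show y + ((c * ‖-y‖) • w + -y) = (c * ‖-y‖) • w by abel]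
        exact PointedCone.smul_mem _ (by positivity) hw)
    exact ⟨1, IsIdempotentElem.one, by simp [le_antisymm hF.le hle]⟩
  · push Not at hint
    have hQ : ∀ w ∈ F, (w 0 + w 1 - w 2 - w 3) ^ 2 = (w 0 + w 1) * w 4 :=
      fun w hw => le_antisymm (hF.le hw).2.2 (hint w hw)
    have hidem (x : V) : linealityProj (linealityProj x) = linealityProj x := by
      ext i; fin_cases i <;> simp [linealityProj_apply] <;> ring
    have hheight (x : V) : height (linealityProj x) = 0 := by
      simp [linealityProj_apply, height_apply]; ring
    have hnonneg {x : V} (hx : x ∈ lorentzCylinder) : 0 ≤ height x := by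
      rw [height_apply]; linarith [hx.1, hx.2.1]
    have hzero {x : V} (hx : x ∈ F) (h0 : height x = 0) : linealityProj x = x := by
      obtain ⟨h1, h2, h3⟩ := hF.le hx
      rw [height_apply] at h0
      have h4 : x 4 = 0 := by linarith
      have h5 : x 1 = -x 0 := by linarith
      have h6 : x 3 = -x 2 := by
        rw [h4, h5] at h3
        have : (x 0 + -x 0 - x 2 - x 3) = 0 := by nlinarith
        linarith
      ext i; fin_cases i <;> simp [linealityProj_apply, h4, h5, h6] <;> ring
    by_cases hw : ∃ w ∈ F, height w ≠ 0
    · obtain ⟨w, hw, hne⟩ := hw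
      have hpos : 0 < height w := lt_of_le_of_ne (hnonneg (hF.le hw)) hne.symm
      set w' := w - linealityProj w with hw'
      have hw'F : w' ∈ F := by
        rw [hw', sub_eq_add_neg, ← map_neg]
        exact F.add_mem hw (linealityProj_mem_face hF _)
      have hPw : linealityProj w' = 0 := by rw [hw', map_sub, hidem, sub_self]
      have hhw : height w' = height w := by rw [hw', map_sub, hheight, sub_zero]
      -- The height is nonnegative on the cylinder and vanishes on the lineality space, so it can
      -- serve as coefficient of the ray through `w'`.
      let P : V →ₗ[ℝ] V := linealityProj + ((height w)⁻¹ • height).smulRight w'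
      have hP (x : V) : P x = linealityProj x + ((height w)⁻¹ * height x) • w' := rfl
      have hPF (x : V) (hx : x ∈ F) : P x = x := by
        have hB := polar_eq_of_boundary hQ hx hw
        have hQx := hQ x hx
        have hQw := hQ w hw
        -- D² = (pt' + p't)² - 4pp'tt' vanishes by polarity; below, S² = -D².
        have hD : (x 0 + x 1) * w 4 - (w 0 + w 1) * x 4 = 0 := by
          apply pow_eq_zero_iff two_ne_zero |>.1
          linear_combination -(2 * ((x 0 + x 1 - x 2 - x 3) * (w 0 + w 1 - w 2 - w 3)) +
            ((x 0 + x 1) * w 4 + (w 0 + w 1) * x 4)) * hB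
              + 4 * (w 0 + w 1 - w 2 - w 3) ^ 2 * hQx + 4 * ((x 0 + x 1) * x 4) * hQw
        have hS : (x 0 + x 1 - x 2 - x 3) * height w - (w 0 + w 1 - w 2 - w 3) * height x = 0 := by
          apply pow_eq_zero_iff two_ne_zero |>.1
          simp only [height_apply]
          linear_combination (w 0 + w 1 + w 4) ^ 2 * hQx + (x 0 + x 1 + x 4) ^ 2 * hQw
            - (w 0 + w 1 + w 4) * (x 0 + x 1 + x 4) * hB
            - ((x 0 + x 1) * w 4 - (w 0 + w 1) * x 4) * hD
        rw [height_apply w, height_apply x] at hS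
        have hne' : w 0 + w 1 + w 4 ≠ 0 := hne
        rw [hP, hw']
        ext i
        fin_cases i <;> simp [linealityProj_apply, height_apply] <;> field_simp <;>
          linarith [hD, hS]
      have hmem (x : V) (hx : x ∈ lorentzCylinder) : P x ∈ F := by
        rw [hP]
        exact F.add_mem (linealityProj_mem_face hF x) (PointedCone.smul_mem _
          (mul_nonneg (inv_nonneg.2 hpos.le) (hnonneg hx)) hw'F)
      refine ⟨P, ?_, ?_⟩
      · ext1 x
        change P (P x) = P x
        rw [hP x, map_add, map_smul, hP, hP, hidem, hheight, hPw, hhw, inv_mul_cancel₀ hne]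
        simp
      · ext y
        exact ⟨fun ⟨x, hx, hxy⟩ => hxy ▸ hmem x hx, fun hy => ⟨y, hF.le hy, hPF y hy⟩⟩
    · push Not at hw
      refine ⟨linealityProj, LinearMap.ext hidem, ?_⟩
      ext y
      exact ⟨fun ⟨x, _, hxy⟩ => hxy ▸ linealityProj_mem_face hF x,
        fun hy => ⟨y, hF.le hy, hzero hy (hw y hy)⟩⟩

/-- A face is spanned by the basis vectors in its support, so the coordinate projection onto the
support works. -/
theorem isProjectionallyExposed_orthant : IsProjectionallyExposed orthant := by
  classical
  intro F hF
  refine ⟨hF, ?_⟩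
  let m : Fin 5 → ℝ := fun i => if ∃ w ∈ F, w i ≠ 0 then 1 else 0
  have hbasis (i : Fin 5) (h : ∃ w ∈ F, w i ≠ 0) : EuclideanSpace.single i (1 : ℝ) ∈ F := by
    obtain ⟨w, hw, hne⟩ := h
    have hpos : 0 < w i := lt_of_le_of_ne (hF.le hw i) hne.symm
    refine hF.mem_of_smul_add_mem (x := EuclideanSpace.single i (1 : ℝ))
      (y := w - w i • EuclideanSpace.single i (1 : ℝ)) (a := w i) ?_ ?_ hpos (by simpa using hw)
    · intro j; by_cases hj : j = i <;> simp [hj]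
    · intro j; by_cases hj : j = i <;> simp [hj, hF.le hw j]
  let P : V →ₗ[ℝ] V :=
    { toFun := fun x => WithLp.toLp 2 fun i => m i * x i
      map_add' := fun x y => by ext i; simp [mul_add]
      map_smul' := fun c x => by ext i; simp [mul_left_comm] }
  have hP (x : V) (i : Fin 5) : P x i = m i * x i := rfl
  refine ⟨P, ?_, ?_⟩
  · ext x i
    change P (P x) i = P x i
    simp only [hP, m]
    split_ifs <;> simp
  · ext y
    constructor
    · rintro ⟨x, hx, rfl⟩
      have : P x = ∑ i, (m i * x i) • EuclideanSpace.single i (1 : ℝ) := by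
        ext j
        simp [hP, Finset.sum_apply, Pi.single_apply]
      rw [this]
      refine F.sum_mem fun i _ => ?_
      by_cases h : ∃ w ∈ F, w i ≠ 0
      · exact PointedCone.smul_mem _ (by simpa [m, h] using hx i) (hbasis i h)
      · simp [m, h]
    · intro hy
      refine ⟨y, hF.le hy, ?_⟩
      ext i
      rw [hP]
      by_cases h : y i = 0
      · simp [h]
      · have : m i = 1 := if_pos ⟨y, hy, h⟩
        rw [this, one_mul]

/-! ### The face that is not projectionally exposed -/

/-- The cone over a square cut out of the intersection by the hyperplane `x 4 = 0`. -/
def squareFace : PointedCone ℝ V where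
  carrier := {x | x ∈ lorentzCylinder ⊓ orthant ∧ x 4 = 0}
  zero_mem' := ⟨Submodule.zero_mem _, rfl⟩
  add_mem' := fun ⟨hx, hx'⟩ ⟨hy, hy'⟩ => ⟨Submodule.add_mem _ hx hy, by simp [hx', hy']⟩
  smul_mem' := fun c _ ⟨hx, hx'⟩ => ⟨Submodule.smul_mem _ c hx, by
    simp [PiLp.smul_apply, hx']⟩

theorem isFaceOf_squareFace : squareFace.IsFaceOf (lorentzCylinder ⊓ orthant) where
  le := fun _ hx => hx.1
  mem_of_smul_add_mem := by
    intro x y a hx hy ha h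
    refine ⟨hx, ?_⟩
    have h4 := h.2
    simp only [PiLp.add_apply, PiLp.smul_apply, smul_eq_mul] at h4
    have h1 := hx.2 4
    have h2 := hy.2 4
    nlinarith

/-- Linear coefficient of a quadratic that is nonnegative near its root `0`. -/
theorem eq_zero_of_forall_linear_add_sq_nonneg {a b : ℝ}
    (h : ∀ s : ℝ, |s| ≤ 1 / 2 → 0 ≤ s * a + s ^ 2 * b) : a = 0 := by
  have h' : ∀ s : ℝ, 0 < s → s ≤ 1 / 2 → |a| ≤ s * b := by
    intro s hs hs'
    have h1 := h s (by rw [abs_of_pos hs]; exact hs')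
    have h2 := h (-s) (by rw [abs_neg, abs_of_pos hs]; exact hs')
    rw [abs_le]
    constructor <;> nlinarith
  by_contra hne
  have ha : 0 < |a| := abs_pos.2 hne
  have hb : 0 < b := by have := h' (1 / 2) (by norm_num) le_rfl; linarith
  have := h' (min (1 / 2) (|a| / (2 * b))) (by positivity) (min_le_left _ _)
  have h3 : min (1 / 2) (|a| / (2 * b)) * b ≤ |a| / (2 * b) * b := by
    gcongr; exact min_le_right _ _
  have h4 : |a| / (2 * b) * b = |a| / 2 := by field_simp
  linarith

theorem not_isProjectionallyExposed_inf :
    ¬ IsProjectionallyExposed (lorentzCylinder ⊓ orthant) := by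
  intro H
  obtain ⟨-, P, hidem, hP⟩ := H _ isFaceOf_squareFace
  have hmap (x : V) (hx : x ∈ lorentzCylinder ⊓ orthant) : P x ∈ squareFace := by
    rw [← SetLike.mem_coe, ← hP]; exact ⟨x, hx, rfl⟩
  have hfix (x : V) (hx : x ∈ squareFace) : P x = x := by
    rw [← SetLike.mem_coe, ← hP] at hx
    obtain ⟨y, -, rfl⟩ := hx
    exact LinearMap.congr_fun hidem y
  let e : Fin 5 → V := fun i => EuclideanSpace.single i (1 : ℝ)
  have hdec (a b c d t : ℝ) : (!₂[a, b, c, d, t] : V) =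
      a • e 0 + b • e 1 + c • e 2 + d • e 3 + t • e 4 := by
    ext i; fin_cases i <;> simp [e]
  have hPdec (a b c d t : ℝ) (i : Fin 5) : P !₂[a, b, c, d, t] i =
      a * P (e 0) i + b * P (e 1) i + c * P (e 2) i + d * P (e 3) i + t * P (e 4) i := by
    rw [hdec]; simp
  have hmem {a b c d t : ℝ} (ha : 0 ≤ a) (hb : 0 ≤ b) (hc : 0 ≤ c) (hd : 0 ≤ d) (ht : 0 ≤ t)
      (hQ : (a + b - c - d) ^ 2 ≤ (a + b) * t) :
      (!₂[a, b, c, d, t] : V) ∈ lorentzCylinder ⊓ orthant := by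
    refine ⟨⟨add_nonneg ha hb, ht, hQ⟩, fun i => ?_⟩
    fin_cases i <;> simpa
  have hfix' {a b c d : ℝ} (ha : 0 ≤ a) (hb : 0 ≤ b) (hc : 0 ≤ c) (hd : 0 ≤ d)
      (hQ : a + b = c + d) : P !₂[a, b, c, d, 0] = !₂[a, b, c, d, 0] :=
    hfix _ ⟨hmem ha hb hc hd le_rfl (by
      rw [show a + b - c - d = 0 by linarith]; simp), rfl⟩
  have h02 (i : Fin 5) := congrArg (fun x : V => x i)
    (hfix' (a := 1) (b := 0) (c := 1) (d := 0) (by simp) (by simp) (by simp) (by simp) (by simp))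
  have h03 (i : Fin 5) := congrArg (fun x : V => x i)
    (hfix' (a := 1) (b := 0) (c := 0) (d := 1) (by simp) (by simp) (by simp) (by simp) (by simp))
  have h12 (i : Fin 5) := congrArg (fun x : V => x i)
    (hfix' (a := 0) (b := 1) (c := 1) (d := 0) (by simp) (by simp) (by simp) (by simp) (by simp))
  simp only [hPdec] at h02 h03 h12
  have hnonneg {a b c d t : ℝ} (i : Fin 5) (ha : 0 ≤ a) (hb : 0 ≤ b) (hc : 0 ≤ c) (hd : 0 ≤ d)
      (ht : 0 ≤ t) (hQ : (a + b - c - d) ^ 2 ≤ (a + b) * t) :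
      0 ≤ a * P (e 0) i + b * P (e 1) i + c * P (e 2) i + d * P (e 3) i + t * P (e 4) i := by
    rw [← hPdec]
    exact (hmap _ (hmem ha hb hc hd ht hQ)).1.2 i
  -- Move off e₁ + e₂, whose coordinate 0 vanishes, along ±e₂, paying s² in e₄: the linear term must
  -- vanish.
  have c02 : P (e 2) 0 = 0 := by
    refine eq_zero_of_forall_linear_add_sq_nonneg (b := P (e 4) 0) fun s hs => ?_
    obtain ⟨hs1, hs2⟩ := abs_le.1 hs
    have := hnonneg (a := 0) (b := 1) (c := 1 + s) (d := 0) (t := s ^ 2) 0 (by simp) (by simp)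
      (by linarith) (by simp) (by positivity) (by nlinarith)
    have : P (e 1) 0 + P (e 2) 0 = 0 := by simpa using h12 0
    linarith
  have c12 : P (e 2) 1 = 0 := by
    refine eq_zero_of_forall_linear_add_sq_nonneg (b := P (e 4) 1) fun s hs => ?_
    obtain ⟨hs1, hs2⟩ := abs_le.1 hs
    have := hnonneg (a := 1) (b := 0) (c := 1 + s) (d := 0) (t := s ^ 2) 1 (by simp) (by simp)
      (by linarith) (by simp) (by positivity) (by nlinarith)
    have : P (e 0) 1 + P (e 2) 1 = 0 := by simpa using h02 1
    linarith
  have c20 : P (e 0) 2 = 0 := by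
    refine eq_zero_of_forall_linear_add_sq_nonneg (b := 2 * P (e 4) 2) fun s hs => ?_
    obtain ⟨hs1, hs2⟩ := abs_le.1 hs
    -- Here p = 1 + s ≥ 1/2, so t = 2s² suffices.
    have := hnonneg (a := 1 + s) (b := 0) (c := 0) (d := 1) (t := 2 * s ^ 2) 2 (by linarith)
      (by simp) (by simp) (by simp) (by positivity) (by nlinarith [sq_nonneg s])
    have : P (e 0) 2 + P (e 3) 2 = 0 := by simpa using h03 2
    linarith
  have c30 : P (e 0) 3 = 0 := by
    refine eq_zero_of_forall_linear_add_sq_nonneg (b := 2 * P (e 4) 3) fun s hs => ?_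
    obtain ⟨hs1, hs2⟩ := abs_le.1 hs
    have := hnonneg (a := 1 + s) (b := 0) (c := 1) (d := 0) (t := 2 * s ^ 2) 3 (by linarith)
      (by simp) (by simp) (by simp) (by positivity) (by nlinarith [sq_nonneg s])
    have : P (e 0) 3 + P (e 2) 3 = 0 := by simpa using h02 3
    linarith
  have hbal (x : V) (hx : x ∈ squareFace) : x 0 + x 1 - x 2 - x 3 = 0 := by
    have h3 := hx.1.1.2.2
    rw [hx.2, mul_zero] at h3
    exact pow_eq_zero_iff two_ne_zero |>.1 (le_antisymm h3 (sq_nonneg _))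
  -- Subtracting `b4` from `b2` shows that P e₂ is balanced, yet its first four coordinates are (0,
  -- 0, 1, 0).
  have b4 := hbal _ (hmap _ (hmem (a := 1) (b := 0) (c := 1) (d := 0) (t := 1) (by simp) (by simp)
    (by simp) (by simp) (by simp) (by simp)))
  have b2 := hbal _ (hmap _ (hmem (a := 1) (b := 0) (c := 2) (d := 0) (t := 1) (by simp) (by simp)
    (by simp) (by simp) (by simp) (by norm_num)))
  have b0 := hbal _ (hmap _ (hmem (a := 1) (b := 0) (c := 1) (d := 0) (t := 0) (by simp) (by simp)
    (by simp) (by simp) (by simp) (by simp)))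
  simp only [hPdec] at b4 b2 b0
  have e2 : P (e 0) 2 + P (e 2) 2 = 1 := by simpa using h02 2
  have e3 : P (e 0) 3 + P (e 2) 3 = 0 := by simpa using h02 3
  linarith

/-! ### Amenability of the intersection -/

theorem isAmenable_inf : IsAmenable (lorentzCylinder ⊓ orthant) := by
  classical
  intro F hF
  have hex (i : Fin 5) : ∃ w ∈ F, (∃ v ∈ F, v i ≠ 0) → 0 < w i := by
    by_cases h : ∃ v ∈ F, v i ≠ 0
    · obtain ⟨v, hv, hne⟩ := h
      exact ⟨v, hv, fun _ => lt_of_le_of_ne ((hF.le hv).2 i) hne.symm⟩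
    · exact ⟨0, F.zero_mem, fun h' => absurd h' h⟩
  choose w hwF hwpos using hex
  have hsum : ∑ i, w i ∈ F := F.sum_mem fun i _ => hwF i
  have hsumpos (i : Fin 5) (h : ∃ v ∈ F, v i ≠ 0) : 0 < (∑ j, w j) i := by
    rw [WithLp.ofLp_sum, Finset.sum_apply]
    exact Finset.sum_pos' (fun j _ => (hF.le (hwF j)).2 i) ⟨i, Finset.mem_univ i, hwpos i h⟩
  obtain ⟨c, hc, hcw⟩ : ∃ c : ℝ, 0 < c ∧
      ∀ i, (∃ v ∈ F, v i ≠ 0) → 1 ≤ c * (∑ j, w j) i := by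
    -- Coordinates outside the support contribute 0⁻¹ = 0.
    refine ⟨1 + ∑ i, |((∑ j, w j) i)⁻¹|, by positivity, fun i hi => ?_⟩
    have hpos := hsumpos i hi
    have h1 : |((∑ j, w j) i)⁻¹| ≤ ∑ i, |((∑ j, w j) i)⁻¹| :=
      Finset.single_le_sum (f := fun i => |((∑ j, w j) i)⁻¹|) (fun _ _ => abs_nonneg _)
        (Finset.mem_univ i)
    calc (1 : ℝ) = ((∑ j, w j) i)⁻¹ * (∑ j, w j) i := (inv_mul_cancel₀ hpos.ne').symm
      _ ≤ _ := by gcongr; linarith [le_abs_self ((∑ j, w j) i)⁻¹]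
  have horth {e : V} {d : ℝ} (hd : 0 ≤ d)
      (he : ∀ i, 0 ≤ e i ∧ ((∃ v ∈ F, v i ≠ 0) → 1 ≤ d * e i)) {x y : V}
      (hx : x ∈ Submodule.span ℝ (F : Set V)) (hy : y ∈ orthant) :
      x + (d * ‖x - y‖) • e ∈ orthant := by
    intro i
    simp only [PiLp.add_apply, PiLp.smul_apply, smul_eq_mul]
    by_cases h : ∃ v ∈ F, v i ≠ 0
    · have h1 := PiLp.norm_apply_le (x - y) i
      rw [PiLp.sub_apply, Real.norm_eq_abs] at h1
      have h2 := neg_abs_le (x i - y i)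
      nlinarith [hy i, (he i).2 h, norm_nonneg (x - y)]
    · push Not at h
      have : x i = 0 := by
        induction hx using Submodule.span_induction with
        | mem x hx => exact h x hx
        | zero => rfl
        | add x y _ _ hx hy => simp [hx, hy]
        | smul r x _ hx => simp [hx]
      rw [this, zero_add]
      have := (he i).1
      positivity
  by_cases hint : ∃ v ∈ F, (v 0 + v 1 - v 2 - v 3) ^ 2 < (v 0 + v 1) * v 4
  · obtain ⟨v, hv, hQ⟩ := hint
    obtain ⟨k, hk, hkv⟩ := exists_smul_add_mem_lorentzCylinder (hF.le hv).1 hQ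
    have hmem : k • v + c • ∑ j, w j ∈ F :=
      F.add_mem (PointedCone.smul_mem _ hk.le hv) (PointedCone.smul_mem _ hc.le hsum)
    refine isAmenableFace_of_forall_add_smul_mem hF hmem zero_le_one fun x hx y hy => ⟨?_, ?_⟩
    · have := add_mem (add_mem (hkv (x - y)) hy.1) (PointedCone.smul_mem lorentzCylinder
        (show 0 ≤ c * ‖x - y‖ by positivity) (hF.le hsum).1)
      rw [SetLike.mem_coe]
      convert this using 1
      module
    · refine horth zero_le_one (fun i => ⟨(hF.le hmem).2 i, fun hi => ?_⟩) hx hy.2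
      have h1 := hcw i hi
      have h2 := mul_nonneg hk.le ((hF.le hv).2 i)
      simp only [PiLp.add_apply, PiLp.smul_apply, smul_eq_mul]
      linarith
  · push Not at hint
    have hQ : ∀ w ∈ F, (w 0 + w 1 - w 2 - w 3) ^ 2 = (w 0 + w 1) * w 4 :=
      fun w hw => le_antisymm (hF.le hw).1.2.2 (hint w hw)
    -- Polarity extends to the span one argument at a time, so s² = pt there.
    have hpolar {a x : V} (ha : a ∈ F) (hx : x ∈ Submodule.span ℝ (F : Set V)) :
        2 * ((a 0 + a 1 - a 2 - a 3) * (x 0 + x 1 - x 2 - x 3)) =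
          (a 0 + a 1) * x 4 + (x 0 + x 1) * a 4 := by
      induction hx using Submodule.span_induction with
      | mem x hx => exact polar_eq_of_boundary hQ ha hx
      | zero => simp
      | add x y _ _ hx hy => simp only [PiLp.add_apply]; linarith
      | smul r x _ hx => simp only [PiLp.smul_apply, smul_eq_mul]; linear_combination r * hx
    have hspan {x y : V} (hx : x ∈ Submodule.span ℝ (F : Set V))
        (hy : y ∈ Submodule.span ℝ (F : Set V)) :
        2 * ((x 0 + x 1 - x 2 - x 3) * (y 0 + y 1 - y 2 - y 3)) =
          (x 0 + x 1) * y 4 + (y 0 + y 1) * x 4 := by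
      induction hx using Submodule.span_induction with
      | mem x hx => exact hpolar hx hy
      | zero => simp
      | add x y _ _ hx hy => simp only [PiLp.add_apply]; linarith
      | smul r x _ hx => simp only [PiLp.smul_apply, smul_eq_mul]; linear_combination r * hx
    refine isAmenableFace_of_forall_add_smul_mem hF hsum hc.le fun x hx y hy => ?_
    have ho := horth hc.le (fun i => ⟨(hF.le hsum).2 i, hcw i⟩) hx hy.2
    have hs : x + (c * ‖x - y‖) • ∑ j, w j ∈ Submodule.span ℝ (F : Set V) :=
      Submodule.add_mem _ hx (Submodule.smul_mem _ _ (Submodule.subset_span hsum))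
    generalize x + (c * ‖x - y‖) • ∑ j, w j = z at ho hs
    exact ⟨⟨add_nonneg (ho 0) (ho 1), ho 4, by linarith [hspan hs hs]⟩, ho⟩

end ConvexCones

theorem theorem2 :
    ∃ K₁ K₂ : PointedCone ℝ (EuclideanSpace ℝ (Fin 5)),
      IsClosed (K₁ : Set (EuclideanSpace ℝ (Fin 5))) ∧
      IsClosed (K₂ : Set (EuclideanSpace ℝ (Fin 5))) ∧
      ConvexCones.IsProjectionallyExposed K₁ ∧
      ConvexCones.IsProjectionallyExposed K₂ ∧
      ¬ ConvexCones.IsProjectionallyExposed (K₁ ⊓ K₂) ∧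
      ConvexCones.IsAmenable (K₁ ⊓ K₂) :=
  ⟨ConvexCones.lorentzCylinder, ConvexCones.orthant, ConvexCones.isClosed_lorentzCylinder,
    ConvexCones.isClosed_orthant, ConvexCones.isProjectionallyExposed_lorentzCylinder,
    ConvexCones.isProjectionallyExposed_orthant, ConvexCones.not_isProjectionallyExposed_inf,
    ConvexCones.isAmenable_inf⟩
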